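/- **Model.** Let $N$ be the number of rings, $R_0,\lambda_T,\lambda_C,\lambda_{GS},a>0$, $b\in\mathbb R$, $\delta\in[0,1]$, and for $i=1,\dots,N$ let $h_{u_i}\ge 0$ and $R_{u_i}\ge 0$. Put $R_{f_i}=\frac{R_0}{N}i$ and $$p_i=e^{-\lambda_{GS}\pi R_{f_{i-1}}^2}\left(1-e^{-\lambda_{GS}\pi(R_{f_i}^2-R_{f_{i-1}}^2)}\right),$$ $$p_{L_i}(r)=\frac{1}{1+a\exp\left(-b\left(\frac{180}{\pi}\arctan\frac{h_{u_i}}{r}-a\right)\right)},\qquad p_{N_i}(r)=1-p_{L_i}(r),$$ where the angle $\arctan\frac{h_{u_i}}{r}$ is read as $\frac{\pi}{2}$ at $r=0$. The typical user is located in the plane $\mathbb R^2$ (height $0$), at a point independent of the processes below. The terrestrial base stations (TBSs) form a homogeneous Poisson point process of density $\lambda_T$ in the plane, at height $0$. The centers of the clusters other than the user's own form a homogeneous Poisson point process of density $\lambda_C$ in the plane. Independently for each cluster, and independently of the user and of the centers: the accessible rooftops, relative to the center, form a homogeneous Poisson point process of density $\lambda_{GS}$, and, independently of the rooftops, the cluster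 is selected for deployment with probability $\delta$. If it is selected and the distance from its center to the nearest accessible rooftop lies in $(R_{f_{i-1}},R_{f_i})$, the cluster has one aerial base station (ABS), associated with a ground station located in ring $i$, at altitude $h_{u_i}$; its horizontal location is the cluster center displaced by a vector uniformly distributed on the circle of center $0$ and radius $R_{u_i}$, independent of everything else. Finally, an ABS associated with ring $i$ at horizontal distance $r$ from the user is in line of sight (LoS) with conditional probability $p_{L_i}(r)$, independently for different ABSs, and is NLoS otherwise. **Lemma.** Let $D_T$, $D_{L_i}$, $D_{N_i}$ be the Euclidean distances from the typical user to the closest TBS, to the closest LoS ABS associated with a ground station in ring $i$, and to the closest NLoS ABS associated with a ground station in ring $i$, respectively (with value $+\infty$ if there is none). Then for every $i\in\{1,\dots,N\}$ and every $d\in\mathbb R$ $$\mathbb P(D_T\le d)=\left[1-\exp\left(-\pi\lambda_T d^2\right)\right]\mathbf 1_{[0,\infty)}(d),$$ $$\mathbb P(D_{L_i}\le d)=\left[1-\exp\left(-2\pi p_i\delta\lambda_C\int_0^{\sqrt{d^2-h_{u_i}^2}} r\,p_{L_i}(r)\,dr\right)\right]\mathbf 1_{[h_{u_i},\infty)}(d),$$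 $$\mathbb P(D_{N_i}\le d)=\left[1-\exp\left(-2\pi p_i\delta\lambda_C\int_0^{\sqrt{d^2-h_{u_i}^2}} r\,p_{N_i}(r)\,dr\right)\right]\mathbf 1_{[h_{u_i},\infty)}(d).$$ -/

import Mathlib

open MeasureTheory ProbabilityTheory

namespace TUAV

/-- The horizontal plane `ℝ²` with its Euclidean norm. -/
abbrev Plane : Type := EuclideanSpace ℝ (Fin 2)

/-- The number of points of the point family `X` in `B` (possibly infinite). -/
noncomputable def count {Ω : Type*} (X : ℕ → Ω → Plane) (B : Set Plane) (ω : Ω) : ℕ∞ :=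
  Set.encard {k : ℕ | X k ω ∈ B}

/-- The points `X 0, X 1, …` are a measurable enumeration of a homogeneous Poisson point process
of intensity `lam` on the plane: the number of points in a bounded Borel set `B` is Poisson
distributed with mean `lam * |B|`, and the numbers of points in finitely many pairwise disjoint
bounded Borel sets are mutually independent. (For `lam > 0` such a process has almost surely
infinitely many points, so that the index set may be taken to be `ℕ`.) -/
structure IsHomogeneousPPP {Ω : Type*} [MeasurableSpace Ω] (μ : Measure Ω)
    (lam : ℝ) (X : ℕ → Ω → Plane) : Prop where
  measurable : ∀ k, Measurable (X k)
  law : ∀ B : Set Plane, Bornology.IsBounded B → MeasurableSet B →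
    HasLaw (count X B)
      ((poissonMeasure (lam * (volume : Measure Plane).real B).toNNReal).map
        (Nat.cast : ℕ → ℕ∞)) μ
  indep : ∀ (m : ℕ) (B : Fin m → Set Plane),
    (∀ j, Bornology.IsBounded (B j)) → (∀ j, MeasurableSet (B j)) →
    Pairwise (fun j l => Disjoint (B j) (B l)) →
    iIndepFun (fun j => count X (B j)) μ

/-- The elevation angle (in radians) of a point at altitude `h` seen from horizontal distance
`r ≥ 0`: it is `arctan (h / r)`, and `π / 2` straight overhead. -/
noncomputable def elevation (r h : ℝ) : ℝ :=
  if r = 0 then Real.pi / 2 else Real.arctan (h / r)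

/-- Deterministic parameters of the network. The ring with index `i : Fin N` is the `(i+1)`-st ring
counted from the cluster center. -/
structure Params (N : ℕ) where
  /-- density of the TBSs -/
  lamT : ℝ
  /-- density of the cluster centers -/
  lamC : ℝ
  /-- density of the accessible rooftops -/
  lamGS : ℝ
  /-- fraction of the clusters in which T-UAVs are deployed -/
  δ : ℝ
  /-- cluster radius -/
  R0 : ℝ
  /-- first constant of the LoS probability -/
  a : ℝ
  /-- second constant of the LoS probability -/
  b : ℝ
  /-- altitude of an ABS whose GS is in ring `i` -/
  h : Fin N → ℝ
  /-- horizontal distance between an ABS whose GS is in ring `i` and its cluster center -/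
  Ru : Fin N → ℝ
  lamT_pos : 0 < lamT
  lamC_pos : 0 < lamC
  lamGS_pos : 0 < lamGS
  δ_nonneg : 0 ≤ δ
  δ_le_one : δ ≤ 1
  R0_pos : 0 < R0
  a_pos : 0 < a
  h_nonneg : ∀ i, 0 ≤ h i
  Ru_nonneg : ∀ i, 0 ≤ Ru i

namespace Params

variable {N : ℕ} (P : Params N)

/-- The radii `R₀ m / N` of the circles that bound the rings. -/
noncomputable def ringRadius (m : ℕ) : ℝ := P.R0 / N * m

/-- The probability `p_i` that the accessible rooftop nearest to a cluster center is in ring `i`. -/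
noncomputable def ringProb (i : Fin N) : ℝ :=
  Real.exp (-P.lamGS * Real.pi * P.ringRadius i ^ 2) *
    (1 - Real.exp (-P.lamGS * Real.pi * (P.ringRadius ((i : ℕ) + 1) ^ 2 - P.ringRadius i ^ 2)))

/-- The LoS probability `p_L(r, h)`. -/
noncomputable def probLoS (r h : ℝ) : ℝ :=
  1 / (1 + P.a * Real.exp (-P.b * (180 / Real.pi * elevation r h - P.a)))

/-- `p_{L_i}(r) = p_L(r, h_{u_i})`. -/
noncomputable def pL (i : Fin N) (r : ℝ) : ℝ := P.probLoS r (P.h i)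

/-- `p_{N_i}(r) = 1 - p_{L_i}(r)`. -/
noncomputable def pN (i : Fin N) (r : ℝ) : ℝ := 1 - P.pL i r

end Params

/-- The random network seen by the typical user, on a probability space `(Ω, μ)`.

The clusters other than the user's own one are centered at the points of a homogeneous PPP,
independent of the user's location. Cluster `k` carries independent marks
(also independent between clusters, of the centers and of the user): the accessible rooftops around
its center (a homogeneous PPP), whether a T-UAV is to be deployed, the direction in which its ABS is
displaced from the center, and a uniform variable that decides between LoS and NLoS. -/
structure Network {N : ℕ} (P : Params N) {Ω : Type*} [MeasurableSpace Ω] (μ : Measure Ω) where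
  /-- location of the typical user -/
  user : Ω → Plane
  /-- locations of the TBSs -/
  tbs : ℕ → Ω → Plane
  /-- cluster centers -/
  center : ℕ → Ω → Plane
  /-- accessible rooftops around the center of cluster `k`, relative to that center -/
  rooftop : ℕ → ℕ → Ω → Plane
  /-- whether cluster `k` is among those in which T-UAVs are deployed -/
  deployed : ℕ → Ω → Bool
  /-- direction of the displacement of the ABS of cluster `k` from the center -/
  angle : ℕ → Ω → ℝ
  /-- variable that decides whether the ABS of cluster `k` is LoS -/
  losMark : ℕ → Ω → ℝ
  user_measurable : Measurable user
  tbs_ppp : IsHomogeneousPPP μ P.lamT tbs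
  center_ppp : IsHomogeneousPPP μ P.lamC center
  rooftop_ppp : ∀ k, IsHomogeneousPPP μ P.lamGS (rooftop k)
  deployed_measurable : ∀ k, Measurable (deployed k)
  deployed_law : ∀ k, μ.real {ω | deployed k ω = true} = P.δ
  angle_measurable : ∀ k, Measurable (angle k)
  angle_uniform : ∀ k, pdf.IsUniform (angle k) (Set.Icc 0 (2 * Real.pi)) μ volume
  losMark_measurable : ∀ k, Measurable (losMark k)
  losMark_uniform : ∀ k, pdf.IsUniform (losMark k) (Set.Icc 0 1) μ volume
  /-- the TBSs are independent of the user -/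
  indep_tbs : IndepFun user (fun ω j => tbs j ω) μ
  /-- the cluster centers are independent of the user -/
  indep_center : IndepFun user (fun ω k => center k ω) μ
  /-- the marks are independent of the user and the cluster centers -/
  indep_marks : IndepFun (fun ω => (user ω, fun k => center k ω))
    (fun ω k => ((fun j => rooftop k j ω), deployed k ω, angle k ω, losMark k ω)) μ
  /-- the marks of different clusters are mutually independent -/
  indep_clusters : iIndepFun
    (fun (k : ℕ) ω => ((fun j => rooftop k j ω), deployed k ω, angle k ω, losMark k ω)) μ
  /-- the four marks of a cluster are mutually independent (this field and the next two) -/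
  indep_rooftop : ∀ k, IndepFun (fun ω j => rooftop k j ω)
    (fun ω => (deployed k ω, angle k ω, losMark k ω)) μ
  indep_deployed : ∀ k, IndepFun (deployed k) (fun ω => (angle k ω, losMark k ω)) μ
  indep_angle : ∀ k, IndepFun (angle k) (losMark k) μ

namespace Network

variable {N : ℕ} {P : Params N} {Ω : Type*} [MeasurableSpace Ω] {μ : Measure Ω}
  (S : Network P μ)

/-- Distance from the center of cluster `k` to the nearest accessible rooftop. -/
noncomputable def rooftopDist (k : ℕ) (ω : Ω) : ℝ := ⨅ j, ‖S.rooftop k j ω‖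

/-- Cluster `k` has an ABS and its GS is in ring `i`: the cluster is among those in which T-UAVs are
deployed and the nearest accessible rooftop is in ring `i`. -/
def HasABS (i : Fin N) (k : ℕ) (ω : Ω) : Prop :=
  S.deployed k ω = true ∧
    P.ringRadius i < S.rooftopDist k ω ∧ S.rooftopDist k ω < P.ringRadius ((i : ℕ) + 1)

/-- Horizontal location of the ABS of cluster `k` if its GS is in ring `i`: a point of the circle
of radius `Ru i` about the cluster center. -/
noncomputable def absLoc (i : Fin N) (k : ℕ) (ω : Ω) : Plane :=
  S.center k ω + P.Ru i • !₂[Real.cos (S.angle k ω), Real.sin (S.angle k ω)]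

/-- The ABS of cluster `k`, with GS in ring `i`, is LoS for the typical user: this has conditional
probability `p_{L_i}(r)` when the horizontal distance from the user to the ABS is `r`. -/
def IsLoS (i : Fin N) (k : ℕ) (ω : Ω) : Prop :=
  S.losMark k ω ≤ P.pL i ‖S.absLoc i k ω - S.user ω‖

/-- The point process of the TBSs. -/
def tbsSet (ω : Ω) : Set Plane := {y | ∃ j, y = S.tbs j ω}

/-- The point process of the (horizontal) locations of the LoS ABSs with GS in ring `i`. -/
def losSet (i : Fin N) (ω : Ω) : Set Plane :=
  {y | ∃ k, S.HasABS i k ω ∧ S.IsLoS i k ω ∧ y = S.absLoc i k ω}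

/-- The point process of the (horizontal) locations of the NLoS ABSs with GS in ring `i`. -/
def nlosSet (i : Fin N) (ω : Ω) : Set Plane :=
  {y | ∃ k, S.HasABS i k ω ∧ ¬ S.IsLoS i k ω ∧ y = S.absLoc i k ω}

/-- Distance from the typical user to the closest TBS. -/
noncomputable def distT (ω : Ω) : EReal :=
  ⨅ y ∈ S.tbsSet ω, ((‖y - S.user ω‖ : ℝ) : EReal)

/-- Distance from the typical user (at height `0`) to the closest LoS ABS (at altitude `h i`) with
GS in ring `i`; it is `⊤` if there is none. -/
noncomputable def distL (i : Fin N) (ω : Ω) : EReal :=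
  ⨅ y ∈ S.losSet i ω, ((Real.sqrt (‖y - S.user ω‖ ^ 2 + P.h i ^ 2) : ℝ) : EReal)

/-- Distance from the typical user (at height `0`) to the closest NLoS ABS (at altitude `h i`) with
GS in ring `i`; it is `⊤` if there is none. -/
noncomputable def distN (i : Fin N) (ω : Ω) : EReal :=
  ⨅ y ∈ S.nlosSet i ω, ((Real.sqrt (‖y - S.user ω‖ ^ 2 + P.h i ^ 2) : ℝ) : EReal)

end Network

/-- The distribution function `d ↦ ℙ(D ≤ d)` of an extended real random variable. -/
noncomputable def cdfOf {Ω : Type*} [MeasurableSpace Ω] (μ : Measure Ω) (D : Ω → EReal)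
    (d : ℝ) : ℝ :=
  μ.real {ω | D ω ≤ (d : EReal)}

end TUAV

/-!
Every event `D < d` here says that some point of a marked Poisson process lands in a bounded region,
so everything follows from the probability generating functional
`E ∏ (1 - g (X k)) = exp (-lam * ∫ g)` of a Poisson process
(`IsHomogeneousPPP.lintegral_survival`). For a simple function `g` the product is a finite product
of powers of independent Poisson counts; a general `g` is the increasing limit of simple functions. As
the right-hand side is translation invariant, it is unchanged when the process is seen from an
independent random user (`IsHomogeneousPPP.lintegral_survival_sub`).

The marks of the clusters (rooftops, deployment, direction, LoS variable) are independent of each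
other and of the centers. Hence, given the centers, no cluster produces an ABS of ring `i` with the
required LoS status at horizontal distance less than `ρ` with probability `∏ (1 - g (c k - u))`
(`measure_forall_mark_notMem`), where `g y` (`hitProb`) is the probability of that event for a
cluster at `y`. By translation invariance the displacement from the center to the ABS does not change
`∫ g`, which is `p_i δ` times the integral of `q ‖y‖` over the disc of radius `ρ`; here `q` is the
LoS or the NLoS probability, and polar coordinates give `2 π ∫ r q(r) dr`. The factor `p_i` is a
difference of two void probabilities of the rooftop process.

Finally `P(D ≤ d)` is squeezed between `P(D < d)` and `P(D < d')` for `d' > d`, and the latter is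
continuous in `d'` (`cdfOf_eq_of_lt`).
-/

namespace TUAV

open scoped ENNReal

/-! ### The generating function of the Poisson distribution -/

/-- The generating function `E t ^ n` of the Poisson distribution at `t = 1 - c`. -/
lemma lintegral_one_sub_pow_poissonMeasure (r : NNReal) {c : ℝ≥0∞} (hc : c ≤ 1) :
    ∫⁻ n, (1 - c) ^ n ∂poissonMeasure r = ENNReal.ofReal (Real.exp (-(r * c.toReal))) := by
  have hct : c ≠ ∞ := ne_top_of_le_ne_top ENNReal.one_ne_top hc
  have hc1 : c.toReal ≤ 1 := by simpa using ENNReal.toReal_mono ENNReal.one_ne_top hc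
  have hsub : 1 - c = ENNReal.ofReal (1 - c.toReal) := by
    rw [ENNReal.ofReal_sub _ ENNReal.toReal_nonneg, ENNReal.ofReal_one, ENNReal.ofReal_toReal hct]
  have hs := (NormedSpace.expSeries_div_hasSum_exp ((r : ℝ) * (1 - c.toReal))).mul_left
    (Real.exp (-r))
  rw [← Real.exp_eq_exp_ℝ, ← Real.exp_add] at hs
  rw [poissonMeasure, lintegral_sum_measure]
  simp only [lintegral_smul_measure, lintegral_dirac, hsub, smul_eq_mul]
  have h0 : ∀ n : ℕ, 0 ≤ Real.exp (-(r : ℝ)) * (((r : ℝ) * (1 - c.toReal)) ^ n / n.factorial) :=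
    fun n => mul_nonneg (Real.exp_nonneg _) (div_nonneg (pow_nonneg
      (mul_nonneg r.2 (sub_nonneg.2 hc1)) _) (Nat.cast_nonneg _))
  calc _ = ∑' n : ℕ, ENNReal.ofReal
        (Real.exp (-(r : ℝ)) * (((r : ℝ) * (1 - c.toReal)) ^ n / n.factorial)) := by
        refine tsum_congr fun n => ?_
        rw [← ENNReal.ofReal_pow (sub_nonneg.2 hc1), ← ENNReal.ofReal_mul (by positivity)]
        congr 1
        rw [mul_pow]; ring
    _ = _ := by
        rw [← ENNReal.ofReal_tsum_of_nonneg h0 hs.summable, hs.tsum_eq]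
        congr 2; ring

lemma lintegral_one_sub_pow_map_poissonMeasure (r : NNReal) {c : ℝ≥0∞} (hc : c ≤ 1) :
    ∫⁻ n, (1 - c) ^ n.toNat ∂((poissonMeasure r).map (Nat.cast : ℕ → ℕ∞)) =
      ENNReal.ofReal (Real.exp (-(r * c.toReal))) := by
  rw [lintegral_map Measurable.of_discrete (by fun_prop)]
  simp only [ENat.toNat_natCast]
  exact lintegral_one_sub_pow_poissonMeasure _ hc

/-! ### Void probability of a marked point configuration -/

/-- The probability, given the points `x k`, that none of them is marked when the point at `y`
is marked with probability `g y`, independently for different points. It is the infinite product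
of the numbers `1 - g (x k)`, encoded as the infimum of the (decreasing) partial products, so that
no convergence has to be proved and limits in `g` are exchanges of infima. -/
noncomputable def survival {E : Type*} (g : E → ℝ≥0∞) (x : ℕ → E) : ℝ≥0∞ :=
  ⨅ n, ∏ k ∈ Finset.range n, (1 - g (x k))

lemma antitone_prod_one_sub (a : ℕ → ℝ≥0∞) :
    Antitone fun n => ∏ k ∈ Finset.range n, (1 - a k) :=
  antitone_nat_of_succ_le fun n => by
    rw [Finset.prod_range_succ]
    exact mul_le_of_le_one_right' tsub_le_self

lemma prod_one_sub_le_one (a : ℕ → ℝ≥0∞) (n : ℕ) : ∏ k ∈ Finset.range n, (1 - a k) ≤ 1 :=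
  Finset.prod_le_one' fun _ _ => tsub_le_self

lemma survival_eq_prod {E : Type*} {g : E → ℝ≥0∞} {x : ℕ → E} {m : ℕ}
    (h : ∀ k, m ≤ k → g (x k) = 0) : survival g x = ∏ k ∈ Finset.range m, (1 - g (x k)) := by
  refine le_antisymm (iInf_le _ m) (le_iInf fun n => ?_)
  rcases le_total m n with hmn | hnm
  · rw [Finset.prod_subset (Finset.range_mono hmn)]
    intro k _ hk
    rw [h k (by simpa using hk), tsub_zero]
  · exact antitone_prod_one_sub (fun k => g (x k)) hnm

lemma measurable_survival {E : Type*} [MeasurableSpace E] {g : E → ℝ≥0∞} (hg : Measurable g) :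
    Measurable (survival g) :=
  Measurable.iInf fun _ => Finset.measurable_fun_prod _ fun k _ =>
    (measurable_const.sub (hg.comp (measurable_pi_apply k)))

lemma iInf_prod_one_sub {a : ℕ → ℕ → ℝ≥0∞} (ha : Monotone a) (n : ℕ) :
    ⨅ m, ∏ k ∈ Finset.range n, (1 - a m k) = ∏ k ∈ Finset.range n, (1 - ⨆ m, a m k) := by
  have hanti : Antitone fun m => ∏ k ∈ Finset.range n, (1 - a m k) := fun i j hij =>
    Finset.prod_le_prod' fun k _ => tsub_le_tsub_left (ha hij k) _
  refine tendsto_nhds_unique (tendsto_atTop_iInf hanti) ?_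
  induction n with
  | zero => simp
  | succ n ih =>
    simp only [Finset.prod_range_succ]
    have h1 : Filter.Tendsto (fun m => 1 - a m n) Filter.atTop (nhds (1 - ⨆ m, a m n)) :=
      ENNReal.Tendsto.sub tendsto_const_nhds (tendsto_atTop_iSup fun i j hij => ha hij n)
        (Or.inl ENNReal.one_ne_top)
    refine ENNReal.Tendsto.mul (ih fun i j hij =>
      Finset.prod_le_prod' fun k _ => tsub_le_tsub_left (ha hij k) _) (Or.inr ?_) h1 (Or.inr ?_)
    · exact ne_top_of_le_ne_top ENNReal.one_ne_top tsub_le_self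
    · exact ne_top_of_le_ne_top ENNReal.one_ne_top (prod_one_sub_le_one _ n)

/-- Monotone continuity of the void probability in the marking probability. -/
lemma iInf_survival {E : Type*} {s : ℕ → E → ℝ≥0∞} (hs : Monotone s) {g : E → ℝ≥0∞}
    (hg : ∀ y, ⨆ m, s m y = g y) (x : ℕ → E) : ⨅ m, survival (s m) x = survival g x := by
  unfold survival
  rw [iInf_comm]
  refine iInf_congr fun n => ?_
  rw [iInf_prod_one_sub (a := fun m k => s m (x k)) (fun i j hij k => hs hij (x k))]
  simp only [hg]

lemma survival_antitone {E : Type*} (x : ℕ → E) : Antitone fun g => survival g x :=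
  fun _ _ hgg => iInf_mono fun _ => Finset.prod_le_prod' fun k _ => tsub_le_tsub_left (hgg (x k)) _

lemma survival_le_one {E : Type*} (g : E → ℝ≥0∞) (x : ℕ → E) : survival g x ≤ 1 :=
  iInf_le_of_le 0 (by simp)

/-- If exactly the points in `B` are marked, the void probability is `1` or `0` according to whether
`B` contains no point or some point. -/
lemma survival_indicator {E : Type*} (B : Set E) (x : ℕ → E) :
    survival (B.indicator 1) x = {x : ℕ → E | ∀ k, x k ∉ B}.indicator 1 x := by
  by_cases h : ∀ k, x k ∉ B
  · rw [Set.indicator_of_mem (show x ∈ {x : ℕ → E | ∀ k, x k ∉ B} from h),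
      survival_eq_prod (m := 0) fun k _ => Set.indicator_of_notMem (h k) _]
    simp
  · rw [Set.indicator_of_notMem (show x ∉ {x : ℕ → E | ∀ k, x k ∉ B} from h)]
    push Not at h
    obtain ⟨k, hk⟩ := h
    refine le_antisymm (iInf_le_of_le (k + 1) ?_) bot_le
    rw [Finset.prod_eq_zero (Finset.self_mem_range_succ k)]
    simp [hk]

/-! ### The probability generating functional of a Poisson process -/

variable {Ω : Type*} [MeasurableSpace Ω] {μ : Measure Ω} {lam : ℝ} {X : ℕ → Ω → Plane}

namespace IsHomogeneousPPP

lemma ae_count_ne_top (hX : IsHomogeneousPPP μ lam X) {B : Set Plane}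
    (hB : Bornology.IsBounded B) (hBm : MeasurableSet B) : ∀ᵐ ω ∂μ, count X B ω ≠ ⊤ := by
  have h := hX.law B hB hBm
  rw [h.ae_iff (p := fun n : ℕ∞ => n ≠ ⊤) (Measurable.of_discrete)]
  rw [ae_map_iff (by fun_prop) (MeasurableSet.of_discrete)]
  simp

/-- Independence of the counts gives the product formula for their generating functions. -/
lemma lintegral_prod_one_sub_pow_count (hX : IsHomogeneousPPP μ lam X) (s : Finset ℝ≥0∞)
    (hs : ∀ c ∈ s, c ≤ 1) (B : ℝ≥0∞ → Set Plane) (hB : ∀ c ∈ s, Bornology.IsBounded (B c))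
    (hBm : ∀ c ∈ s, MeasurableSet (B c))
    (hd : ∀ c ∈ s, ∀ c' ∈ s, c ≠ c' → Disjoint (B c) (B c')) :
    ∫⁻ ω, ∏ c ∈ s, (1 - c) ^ (count X (B c) ω).toNat ∂μ =
      ∏ c ∈ s, ENNReal.ofReal
        (Real.exp (-((lam * (volume : Measure Plane).real (B c)).toNNReal * c.toReal))) := by
  let e := s.equivFin.symm
  have hlaw : ∀ j, HasLaw (count X (B (e j))) _ μ := fun j =>
    hX.law (B (e j)) (hB _ (e j).2) (hBm _ (e j).2)
  have hind := hX.indep s.card (fun j => B (e j)) (fun j => hB _ (e j).2) (fun j => hBm _ (e j).2)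
    (fun j l hjl => hd _ (e j).2 _ (e l).2 fun h => hjl (e.injective (Subtype.ext h)))
  -- The law of a count only gives a.e.-measurability, hence the measurable modifications `W j`.
  let W : Fin s.card → Ω → ℕ∞ := fun j => (hlaw j).aemeasurable.mk
  have hW : ∀ j, count X (B (e j)) =ᵐ[μ] W j := fun j => (hlaw j).aemeasurable.ae_eq_mk
  have hWm : ∀ j, Measurable (W j) := fun j => (hlaw j).aemeasurable.measurable_mk
  have hindW : iIndepFun (fun j ω => (1 - (e j : ℝ≥0∞)) ^ (W j ω).toNat) μ :=
    ((iIndepFun_congr hW).1 hind).comp (fun j (n : ℕ∞) => (1 - (e j : ℝ≥0∞)) ^ n.toNat)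
      fun j => Measurable.of_discrete
  calc ∫⁻ ω, ∏ c ∈ s, (1 - c) ^ (count X (B c) ω).toNat ∂μ
      = ∫⁻ ω, ∏ j, (1 - (e j : ℝ≥0∞)) ^ (W j ω).toNat ∂μ := by
        refine lintegral_congr_ae ?_
        filter_upwards [ae_all_iff.2 hW] with ω hω
        rw [← Finset.prod_coe_sort, ← e.prod_comp]
        exact Finset.prod_congr rfl fun j _ => by rw [← hω j]
    _ = ∏ j, ∫⁻ ω, (1 - (e j : ℝ≥0∞)) ^ (W j ω).toNat ∂μ :=
        lintegral_prod_eq_prod_lintegral_of_indepFun _ _ hindW fun j =>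
          (Measurable.of_discrete (f := fun n : ℕ∞ => (1 - (e j : ℝ≥0∞)) ^ n.toNat)).comp (hWm j)
    _ = _ := by
        rw [← Finset.prod_coe_sort s, ← e.prod_comp]
        refine Finset.prod_congr rfl fun j _ => ?_
        rw [← lintegral_one_sub_pow_map_poissonMeasure _ (hs _ (e j).2)]
        exact ((hlaw j).congr (hW j).symm).lintegral_comp
          (f := fun n : ℕ∞ => (1 - (e j : ℝ≥0∞)) ^ n.toNat) Measurable.of_discrete.aemeasurable

/-- For a simple function `g`, grouping the points by the value of `g` turns the product over all
points into a finite product over the nonzero values. The value `0` has to be left out, since its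
level set is unbounded and contains infinitely many points. -/
lemma survival_ae_eq_prod (hX : IsHomogeneousPPP μ lam X) (g : SimpleFunc Plane ℝ≥0∞)
    (hg : Bornology.IsBounded (Function.support g)) :
    ∀ᵐ ω ∂μ, survival g (fun k => X k ω) =
      ∏ c ∈ g.range.filter (· ≠ 0), (1 - c) ^ (count X (g ⁻¹' {c}) ω).toNat := by
  classical
  have hfin : ∀ c : g.range.filter (· ≠ 0), ∀ᵐ ω ∂μ, count X (g ⁻¹' {c.1}) ω ≠ ⊤ := by
    rintro ⟨c, hc⟩
    refine hX.ae_count_ne_top (hg.subset ?_) (g.measurableSet_fiber c)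
    intro y hy
    have hy' : g y = c := hy
    simp only [Function.mem_support, hy']
    exact (Finset.mem_filter.1 hc).2
  filter_upwards [ae_all_iff.2 hfin] with ω hω
  have hset : {k | g (X k ω) ≠ 0}.Finite := by
    have : {k | g (X k ω) ≠ 0} =
        ⋃ c : g.range.filter (· ≠ 0), {k | X k ω ∈ g ⁻¹' {c.1}} := by
      ext k
      simp
    rw [this]
    exact Set.finite_iUnion fun c => Set.encard_ne_top_iff.1 (hω c)
  obtain ⟨m, hm⟩ := hset.bddAbove
  have hz : ∀ k, m + 1 ≤ k → g (X k ω) = 0 := fun k hk => by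
    by_contra h
    exact absurd (hm h) (by omega)
  rw [survival_eq_prod hz]
  have hfactor : ∀ k, 1 - g (X k ω) =
      ∏ c ∈ g.range.filter (· ≠ 0), if g (X k ω) = c then 1 - c else 1 := fun k => by
    rw [Finset.prod_ite_eq]
    split_ifs with h
    · rfl
    · have : g (X k ω) = 0 := by simpa using h
      simp [this]
  rw [Finset.prod_congr rfl fun k _ => hfactor k, Finset.prod_comm]
  refine Finset.prod_congr rfl fun c hc => ?_
  rw [Finset.prod_ite, Finset.prod_const_one, mul_one, Finset.prod_const, count]
  congr 1
  have : {k | X k ω ∈ g ⁻¹' {c}} = ((Finset.range (m + 1)).filter fun k => g (X k ω) = c) := by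
    ext k
    simp only [Set.mem_preimage, Set.mem_singleton_iff, Set.mem_ofPred_eq, Finset.coe_filter,
      Finset.mem_range, iff_and_self]
    intro hk
    by_contra hlt
    exact (Finset.mem_filter.1 hc).2 (hk ▸ hz k (not_lt.1 hlt))
  rw [this, Set.encard_coe_eq_coe_finsetCard, ENat.toNat_natCast]

/-- The probability generating functional at a simple function. -/
lemma lintegral_survival_simpleFunc (hX : IsHomogeneousPPP μ lam X) (hlam : 0 ≤ lam)
    (g : SimpleFunc Plane ℝ≥0∞) (hg1 : ∀ y, g y ≤ 1)
    (hg : Bornology.IsBounded (Function.support g)) :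
    ∫⁻ ω, survival g (fun k => X k ω) ∂μ =
      ENNReal.ofReal (Real.exp (-(lam * (∫⁻ y, g y).toReal))) := by
  classical
  have hbd : ∀ c ∈ g.range.filter (· ≠ 0), Bornology.IsBounded (g ⁻¹' {c}) := fun c hc =>
    hg.subset fun y hy => by
      have hy' : g y = c := hy
      simp only [Function.mem_support, hy']
      exact (Finset.mem_filter.1 hc).2
  have hle : ∀ c ∈ g.range, c ≤ 1 := fun c hc => by
    obtain ⟨y, rfl⟩ := SimpleFunc.mem_range.1 hc
    exact hg1 y
  rw [lintegral_congr_ae (hX.survival_ae_eq_prod g hg),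
    hX.lintegral_prod_one_sub_pow_count _ (fun c hc => hle c (Finset.mem_filter.1 hc).1)
      (fun c => g ⁻¹' {c}) hbd (fun c _ => g.measurableSet_fiber c)
      (fun c _ c' _ h => Disjoint.preimage _ (Set.disjoint_singleton.2 h)),
    ← ENNReal.ofReal_prod_of_nonneg (fun _ _ => Real.exp_nonneg _), ← Real.exp_sum]
  congr 2
  have hsum : ∑ c ∈ g.range, c * volume (g ⁻¹' {c}) =
      ∑ c ∈ g.range.filter (· ≠ 0), c * volume (g ⁻¹' {c}) :=
    (Finset.sum_filter_of_ne (p := (· ≠ 0)) fun c _ h h0 => h (by rw [h0, zero_mul])).symm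
  rw [SimpleFunc.lintegral_eq_lintegral, SimpleFunc.lintegral, hsum,
    ENNReal.toReal_sum, Finset.mul_sum, ← Finset.sum_neg_distrib]
  · refine Finset.sum_congr rfl fun c _ => ?_
    rw [Real.coe_toNNReal _ (by positivity), ENNReal.toReal_mul, measureReal_def]
    ring
  · intro c hc
    exact ENNReal.mul_ne_top
      (ne_top_of_le_ne_top ENNReal.one_ne_top (hle c (Finset.mem_filter.1 hc).1))
      (hbd c hc).measure_lt_top.ne

/-- The probability generating functional of a homogeneous Poisson process: if the points are
marked independently with probability `g`, the number of marked points is zero with probability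
`exp (-lam * ∫ g)`. -/
theorem lintegral_survival (hX : IsHomogeneousPPP μ lam X) (hlam : 0 ≤ lam) [IsFiniteMeasure μ]
    {g : Plane → ℝ≥0∞} (hgm : Measurable g) (hg1 : ∀ y, g y ≤ 1)
    (hg : Bornology.IsBounded (Function.support g)) :
    ∫⁻ ω, survival g (fun k => X k ω) ∂μ =
      ENNReal.ofReal (Real.exp (-(lam * (∫⁻ y, g y).toReal))) := by
  have hle : ∀ m y, SimpleFunc.eapprox g m y ≤ g y := fun m y => by
    rw [← SimpleFunc.iSup_eapprox_apply hgm y]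
    exact le_iSup (fun m => SimpleFunc.eapprox g m y) m
  have hmono : Monotone fun m => (SimpleFunc.eapprox g m : Plane → ℝ≥0∞) :=
    SimpleFunc.monotone_eapprox g
  have hXm : Measurable fun ω k => X k ω := measurable_pi_lambda _ hX.measurable
  have hint : ∫⁻ y, g y ≠ ∞ := by
    refine ne_top_of_le_ne_top hg.measure_lt_top.ne (le_trans (lintegral_mono fun y => ?_)
      (lintegral_indicator_one_le (Function.support g)))
    by_cases hy : g y = 0
    · simp [hy]
    · rw [Set.indicator_of_mem (Function.mem_support.2 hy)]
      exact hg1 y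
  have hanti : Antitone fun m ω => survival (SimpleFunc.eapprox g m) (fun k => X k ω) :=
    fun i j hij ω => survival_antitone _ (hmono hij)
  have hmeas : ∀ m, Measurable fun ω => survival (SimpleFunc.eapprox g m) (fun k => X k ω) :=
    fun m => (measurable_survival (SimpleFunc.eapprox g m).measurable).comp hXm
  have hfin : ∫⁻ ω, survival (SimpleFunc.eapprox g 0) (fun k => X k ω) ∂μ ≠ ∞ :=
    ne_top_of_le_ne_top (measure_ne_top μ Set.univ)
      ((lintegral_mono fun ω => survival_le_one _ _).trans (by simp))
  simp only [← iInf_survival hmono (SimpleFunc.iSup_eapprox_apply hgm)]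
  rw [lintegral_iInf hmeas hanti hfin]
  have hsimple : ∀ m, ∫⁻ ω, survival (SimpleFunc.eapprox g m) (fun k => X k ω) ∂μ =
      ENNReal.ofReal (Real.exp (-(lam * (∫⁻ y, SimpleFunc.eapprox g m y).toReal))) := fun m =>
    hX.lintegral_survival_simpleFunc hlam _ (fun y => (hle m y).trans (hg1 y))
      (hg.subset fun y hy h0 => hy (le_antisymm ((hle m y).trans h0.le) bot_le))
  refine tendsto_nhds_unique (tendsto_atTop_iInf fun i j hij => lintegral_mono (hanti hij)) ?_
  simp only [hsimple]
  refine ENNReal.tendsto_ofReal ((Real.continuous_exp.tendsto _).comp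
    (((ENNReal.tendsto_toReal hint).comp ?_).const_mul lam).neg)
  exact lintegral_tendsto_of_tendsto_of_monotone (fun m => (SimpleFunc.measurable _).aemeasurable)
    (Filter.Eventually.of_forall fun y i j hij => hmono hij y)
    (Filter.Eventually.of_forall fun y => SimpleFunc.tendsto_eapprox hgm y)

lemma measure_count_eq_zero (hX : IsHomogeneousPPP μ lam X) (hlam : 0 ≤ lam) {B : Set Plane}
    (hB : Bornology.IsBounded B) (hBm : MeasurableSet B) :
    μ.real {ω | count X B ω = 0} = Real.exp (-(lam * (volume : Measure Plane).real B)) := by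
  have h := (hX.law B hB hBm).measureReal_eq (p := (· = 0)) MeasurableSet.of_discrete
  have hpre : (Nat.cast : ℕ → ℕ∞) ⁻¹' {n | n = 0} = {0} := by
    ext n
    simp
  rw [h, map_measureReal_apply Measurable.of_discrete MeasurableSet.of_discrete, hpre,
    poissonMeasure_real_singleton, Real.coe_toNNReal _ (by positivity)]
  simp

/-- The probability generating functional of a Poisson process seen from an independent random
point: by stationarity it does not depend on the law of that point. -/
theorem lintegral_survival_sub [IsProbabilityMeasure μ] (hX : IsHomogeneousPPP μ lam X)
    (hlam : 0 ≤ lam) {U : Ω → Plane} (hU : Measurable U)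
    (hind : IndepFun U (fun ω k => X k ω) μ) {g : Plane → ℝ≥0∞} (hgm : Measurable g)
    (hg1 : ∀ y, g y ≤ 1) (hg : Bornology.IsBounded (Function.support g)) :
    ∫⁻ ω, survival g (fun k => X k ω - U ω) ∂μ =
      ENNReal.ofReal (Real.exp (-(lam * (∫⁻ y, g y).toReal))) := by
  have hXm : Measurable fun ω k => X k ω := measurable_pi_lambda _ hX.measurable
  have hF : Measurable fun p : Plane × (ℕ → Plane) => survival g fun k => p.2 k - p.1 :=
    (measurable_survival hgm).comp (measurable_pi_lambda _ fun k =>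
      ((measurable_pi_apply k).comp measurable_snd).sub measurable_fst)
  have hshift : ∀ u : Plane, ∫⁻ x, survival g (fun k => x k - u) ∂μ.map (fun ω k => X k ω) =
      ENNReal.ofReal (Real.exp (-(lam * (∫⁻ y, g y).toReal))) := fun u => by
    have hFu : Measurable fun x : ℕ → Plane => survival g fun k => x k - u :=
      (measurable_survival hgm).comp
        (measurable_pi_lambda _ fun k => (measurable_pi_apply k).sub measurable_const)
    rw [lintegral_map hFu hXm]
    have hsub : Measurable fun y : Plane => y - u := measurable_id.sub measurable_const
    have hbd : Bornology.IsBounded (Function.support fun y => g (y - u)) := by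
      obtain ⟨r, hr⟩ := hg.subset_closedBall 0
      refine (Metric.isBounded_closedBall (x := u) (r := r)).subset fun y hy => ?_
      simpa [dist_eq_norm] using hr (show y - u ∈ Function.support g from hy)
    rw [← lintegral_sub_right_eq_self g u]
    exact hX.lintegral_survival hlam (hgm.comp hsub) (fun y => hg1 _) hbd
  calc ∫⁻ ω, survival g (fun k => X k ω - U ω) ∂μ
      = ∫⁻ p, survival g (fun k => p.2 k - p.1) ∂μ.map (fun ω => (U ω, fun k => X k ω)) :=
        (lintegral_map hF (hU.prodMk hXm)).symm
    _ = ∫⁻ u, ∫⁻ x, survival g (fun k => x k - u) ∂μ.map (fun ω k => X k ω) ∂μ.map U := by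
        rw [hind.map_prod_eq_prod_map_map hU.aemeasurable hXm.aemeasurable,
          lintegral_prod _ hF.aemeasurable]
    _ = _ := by
        have := Measure.isProbabilityMeasure_map (μ := μ) hU.aemeasurable
        simp only [hshift, lintegral_const, measure_univ, mul_one]

lemma measure_forall_sub_notMem [IsProbabilityMeasure μ] (hX : IsHomogeneousPPP μ lam X)
    (hlam : 0 ≤ lam) {U : Ω → Plane} (hU : Measurable U)
    (hind : IndepFun U (fun ω k => X k ω) μ) {B : Set Plane} (hB : Bornology.IsBounded B)
    (hBm : MeasurableSet B) :
    μ {ω | ∀ k, X k ω - U ω ∉ B} =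
      ENNReal.ofReal (Real.exp (-(lam * (volume : Measure Plane).real B))) := by
  have hm : MeasurableSet {ω | ∀ k, X k ω - U ω ∉ B} := by
    have : {ω | ∀ k, X k ω - U ω ∉ B} = ⋂ k, (fun ω => X k ω - U ω) ⁻¹' Bᶜ := by
      ext ω
      simp
    rw [this]
    exact MeasurableSet.iInter fun k => ((hX.measurable k).sub hU) hBm.compl
  have h := hX.lintegral_survival_sub hlam hU hind (g := B.indicator 1)
    (measurable_one.indicator hBm) (fun y => Set.indicator_le_self' (by simp) y)
    (hB.subset Set.support_indicator_subset)
  rw [lintegral_indicator_one hBm] at h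
  rw [measureReal_def, ← h, ← lintegral_indicator_one hm]
  refine lintegral_congr fun ω => ?_
  rw [survival_indicator]
  rfl

end IsHomogeneousPPP

/-! ### Distribution functions of infima -/

/-- If `P(D < d') = F d'` for all `d' ≥ d` and `F` is continuous, then also `P(D ≤ d) = F d`. This
spares the proof that an infimum over the points of a process is attained. -/
lemma cdfOf_eq_of_lt [IsFiniteMeasure μ] {D : Ω → EReal} {F : ℝ → ℝ} {d : ℝ}
    (hF : ContinuousAt F d) (h : ∀ d' : ℝ, d ≤ d' → μ.real {ω | D ω < (d' : EReal)} = F d') :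
    cdfOf μ D d = F d := by
  refine le_antisymm ?_ ?_
  · refine ge_of_tendsto (hF.mono_left (nhdsWithin_le_nhds (s := Set.Ioi d))) ?_
    filter_upwards [self_mem_nhdsWithin] with d' hd'
    rw [← h d' (le_of_lt hd')]
    exact measureReal_mono fun ω hω => lt_of_le_of_lt hω (EReal.coe_lt_coe_iff.2 hd')
  · rw [← h d le_rfl]
    exact measureReal_mono fun ω (hω : D ω < _) => hω.le

lemma measureReal_eq_one_sub_of_compl [IsProbabilityMeasure μ] {A : Set Ω} (hA : MeasurableSet A)
    {r : ℝ} (hr : μ Aᶜ = ENNReal.ofReal (Real.exp r)) : μ.real A = 1 - Real.exp r := by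
  have h := probReal_compl_eq_one_sub (μ := μ) hA
  rw [measureReal_def, hr, ENNReal.toReal_ofReal (Real.exp_nonneg _)] at h
  linarith

lemma volume_real_ball_plane (x : Plane) {r : ℝ} (hr : 0 ≤ r) :
    (volume : Measure Plane).real (Metric.ball x r) = Real.pi * r ^ 2 := by
  rw [measureReal_def, EuclideanSpace.volume_ball_fin_two]
  simp [hr, mul_comm, Real.pi_pos.le]

/-! ### The nearest TBS and the nearest rooftop -/

variable {N : ℕ} {P : Params N}

namespace Params

variable (P) in
lemma ringRadius_nonneg (m : ℕ) : 0 ≤ P.ringRadius m := by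
  have := P.R0_pos
  unfold ringRadius
  positivity

lemma ringRadius_lt_succ (i : Fin N) : P.ringRadius i < P.ringRadius ((i : ℕ) + 1) := by
  have hR := P.R0_pos
  have hN : (0 : ℝ) < N := Nat.cast_pos.2 i.pos
  unfold ringRadius
  gcongr
  simp

lemma ringProb_eq (i : Fin N) : P.ringProb i =
    Real.exp (-(P.lamGS * (Real.pi * P.ringRadius i ^ 2))) -
      Real.exp (-(P.lamGS * (Real.pi * P.ringRadius ((i : ℕ) + 1) ^ 2))) := by
  rw [ringProb, mul_sub, mul_one, ← Real.exp_add]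
  congr 2 <;> ring

lemma ringProb_nonneg (i : Fin N) : 0 ≤ P.ringProb i := by
  have h := P.lamGS_pos
  have h' := P.ringRadius_nonneg i
  have h'' := (P.ringRadius_lt_succ i).le
  rw [ringProb_eq, sub_nonneg, Real.exp_le_exp]
  gcongr

end Params

namespace Network

variable (S : Network P μ)

lemma measurable_tbs (k : ℕ) : Measurable (S.tbs k) := S.tbs_ppp.measurable k

lemma measurable_center (k : ℕ) : Measurable (S.center k) := S.center_ppp.measurable k

lemma distT_lt_iff {ω : Ω} {d : ℝ} :
    S.distT ω < d ↔ ∃ j, S.tbs j ω - S.user ω ∈ Metric.ball (0 : Plane) d := by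
  simp only [distT, tbsSet, iInf_lt_iff, EReal.coe_lt_coe_iff, mem_ball_zero_iff]
  constructor
  · rintro ⟨_, ⟨j, rfl⟩, h⟩
    exact ⟨j, h⟩
  · rintro ⟨j, h⟩
    exact ⟨_, ⟨j, rfl⟩, h⟩

lemma measurable_rooftopDist (k : ℕ) : Measurable (S.rooftopDist k) :=
  Measurable.iInf fun j => ((S.rooftop_ppp k).measurable j).norm

lemma rooftopDist_lt_iff {k : ℕ} {ω : Ω} {r : ℝ} :
    S.rooftopDist k ω < r ↔ ∃ j, ‖S.rooftop k j ω‖ < r :=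
  ciInf_lt_iff ⟨0, by rintro _ ⟨j, rfl⟩; exact norm_nonneg _⟩

variable [IsProbabilityMeasure μ]

lemma cdfOf_distT (d : ℝ) (hd : 0 ≤ d) :
    cdfOf μ S.distT d = 1 - Real.exp (-Real.pi * P.lamT * d ^ 2) := by
  refine cdfOf_eq_of_lt (F := fun d => 1 - Real.exp (-Real.pi * P.lamT * d ^ 2))
    (by fun_prop) fun d' hd' => ?_
  have hm : MeasurableSet {ω | S.distT ω < d'} := by
    simp only [distT_lt_iff, Set.ofPred_exists]
    exact MeasurableSet.iUnion fun j =>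
      ((S.measurable_tbs j).sub S.user_measurable) measurableSet_ball
  refine measureReal_eq_one_sub_of_compl hm ?_
  have h := S.tbs_ppp.measure_forall_sub_notMem P.lamT_pos.le S.user_measurable S.indep_tbs
    (Metric.isBounded_ball (x := (0 : Plane)) (r := d')) measurableSet_ball
  rw [volume_real_ball_plane _ (hd.trans hd')] at h
  convert h using 2
  · ext ω
    simp [distT_lt_iff]
  · congr 1; ring

lemma measureReal_rooftopDist_lt (k : ℕ) {r : ℝ} (hr : 0 ≤ r) :
    μ.real {ω | S.rooftopDist k ω < r} = 1 - Real.exp (-(P.lamGS * (Real.pi * r ^ 2))) := by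
  have h := (S.rooftop_ppp k).measure_count_eq_zero P.lamGS_pos.le
    (Metric.isBounded_ball (x := (0 : Plane)) (r := r)) measurableSet_ball
  rw [volume_real_ball_plane _ hr] at h
  have hc : {ω | count (S.rooftop k) (Metric.ball 0 r) ω = 0} =
      {ω | S.rooftopDist k ω < r}ᶜ := by
    ext ω
    simp [count, rooftopDist_lt_iff, Set.eq_empty_iff_forall_notMem]
  have hm : MeasurableSet {ω | S.rooftopDist k ω < r} :=
    S.measurable_rooftopDist k measurableSet_Iio
  rw [hc, probReal_compl_eq_one_sub hm] at h
  linarith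

/-- The nearest rooftop of a cluster is in ring `i` with probability `p_i`. -/
lemma measure_rooftopDist_mem_ring (i : Fin N) (k : ℕ) :
    μ {ω | P.ringRadius i < S.rooftopDist k ω ∧ S.rooftopDist k ω < P.ringRadius ((i : ℕ) + 1)} =
      ENNReal.ofReal (P.ringProb i) := by
  -- The inner boundary circle of the ring is excluded, but it carries no mass.
  have hle : μ.real {ω | S.rooftopDist k ω ≤ P.ringRadius i} =
      1 - Real.exp (-(P.lamGS * (Real.pi * P.ringRadius i ^ 2))) := by
    have := cdfOf_eq_of_lt (μ := μ) (D := fun ω => (S.rooftopDist k ω : EReal))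
      (F := fun r => 1 - Real.exp (-(P.lamGS * (Real.pi * r ^ 2)))) (d := P.ringRadius i)
      (by fun_prop) fun d' hd' => by
        simpa only [EReal.coe_lt_coe_iff] using
          S.measureReal_rooftopDist_lt k ((P.ringRadius_nonneg i).trans hd')
    simpa only [cdfOf, EReal.coe_le_coe_iff] using this
  have hlt := S.measureReal_rooftopDist_lt k (P.ringRadius_nonneg ((i : ℕ) + 1))
  have hset : {ω | P.ringRadius i < S.rooftopDist k ω ∧
      S.rooftopDist k ω < P.ringRadius ((i : ℕ) + 1)} =
      {ω | S.rooftopDist k ω < P.ringRadius ((i : ℕ) + 1)} \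
        {ω | S.rooftopDist k ω ≤ P.ringRadius i} := by
    ext ω
    simp [and_comm]
  have hsub : {ω | S.rooftopDist k ω ≤ P.ringRadius i} ⊆
      {ω | S.rooftopDist k ω < P.ringRadius ((i : ℕ) + 1)} :=
    fun ω hω => lt_of_le_of_lt hω (P.ringRadius_lt_succ i)
  have hm : MeasurableSet {ω | S.rooftopDist k ω ≤ P.ringRadius i} :=
    S.measurable_rooftopDist k measurableSet_Iic
  rw [← ofReal_measureReal, hset, measureReal_sdiff hsub hm, hle, hlt, P.ringProb_eq]
  congr 1; ring

end Network

/-! ### Independent marking, displacement, polar coordinates -/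

/-- Independent marking: if the marks `m k` are independent of each other and of the points `Y k`,
and a point at `y` is hit by its mark with probability `g y`, then, conditionally on the points, no
point is hit with probability `survival g`. -/
theorem measure_forall_mark_notMem [IsProbabilityMeasure μ] {E M : Type*} [MeasurableSpace E]
    [MeasurableSpace M] {Y : ℕ → Ω → E} {m : ℕ → Ω → M} (hY : ∀ k, Measurable (Y k))
    (hm : ∀ k, Measurable (m k)) (hYm : IndepFun (fun ω k => Y k ω) (fun ω k => m k ω) μ)
    (hind : iIndepFun m μ) {A : Set (E × M)} (hA : MeasurableSet A) {g : E → ℝ≥0∞}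
    (hg : Measurable g) (hgA : ∀ k y, μ {ω | (y, m k ω) ∈ A} = g y) :
    μ {ω | ∀ k, (Y k ω, m k ω) ∉ A} = ∫⁻ ω, survival g (fun k => Y k ω) ∂μ := by
  have hY' : Measurable fun ω k => Y k ω := measurable_pi_lambda _ hY
  have hm' : Measurable fun ω k => m k ω := measurable_pi_lambda _ hm
  -- `T n`: none of the first `n` points is hit. Its probability is computed by Fubini, conditioning
  -- on the points.
  let T : ℕ → Set ((ℕ → E) × (ℕ → M)) := fun n => ⋂ k ∈ Finset.range n, {p | (p.1 k, p.2 k) ∉ A}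
  have hT : ∀ n, MeasurableSet (T n) := fun n =>
    Finset.measurableSet_biInter _ fun k _ =>
      (show Measurable fun p : (ℕ → E) × (ℕ → M) => (p.1 k, p.2 k) by fun_prop) hA.compl
  have hfin : ∀ n, μ {ω | ((fun k => Y k ω), fun k => m k ω) ∈ T n} =
      ∫⁻ ω, ∏ k ∈ Finset.range n, (1 - g (Y k ω)) ∂μ := fun n => by
    have hsec : ∀ y : ℕ → E, μ.map (fun ω k => m k ω) (Prod.mk y ⁻¹' T n) =
        ∏ k ∈ Finset.range n, (1 - g (y k)) := fun y => by
      rw [Measure.map_apply hm' (measurable_prodMk_left (hT n))]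
      have hset : (fun ω k => m k ω) ⁻¹' (Prod.mk y ⁻¹' T n) =
          ⋂ k ∈ Finset.range n, m k ⁻¹' (Prod.mk (y k) ⁻¹' Aᶜ) := by
        ext ω
        simp [T]
      rw [hset, hind.measure_inter_preimage_eq_mul _
        (fun k _ => measurable_prodMk_left hA.compl)]
      refine Finset.prod_congr rfl fun k _ => ?_
      rw [← hgA k (y k), ← prob_compl_eq_one_sub]
      · rfl
      · exact (measurable_const.prodMk (hm k)) hA
    have hmap : μ {ω | ((fun k => Y k ω), fun k => m k ω) ∈ T n} =
        μ.map (fun ω => ((fun k => Y k ω), fun k => m k ω)) (T n) :=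
      (Measure.map_apply (hY'.prodMk hm') (hT n)).symm
    rw [hmap, hYm.map_prod_eq_prod_map_map hY'.aemeasurable hm'.aemeasurable,
      Measure.prod_apply (hT n)]
    simp only [hsec]
    rw [lintegral_map (f := fun y : ℕ → E => ∏ k ∈ Finset.range n, (1 - g (y k))) _ hY']
    exact Finset.measurable_fun_prod _ fun k _ =>
      measurable_const.sub (hg.comp (measurable_pi_apply k))
  have hset : {ω | ∀ k, (Y k ω, m k ω) ∉ A} =
      ⋂ n, {ω | ((fun k => Y k ω), fun k => m k ω) ∈ T n} := by
    ext ω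
    simp only [Set.mem_ofPred_eq, Set.mem_iInter, T, Finset.mem_range]
    exact ⟨fun h n k _ => h k, fun h k => h (k + 1) k k.lt_succ_self⟩
  have hanti : Antitone fun n => {ω | ((fun k => Y k ω), fun k => m k ω) ∈ T n} :=
    fun i j hij ω hω => by
      simp only [Set.mem_ofPred_eq, Set.mem_iInter, T, Finset.mem_range] at hω ⊢
      exact fun k hk => hω k (hk.trans_le hij)
  rw [hset, hanti.measure_iInter (fun n => ((hY'.prodMk hm') (hT n)).nullMeasurableSet)
    ⟨0, measure_ne_top _ _⟩]
  simp only [hfin, survival]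
  rw [lintegral_iInf]
  · exact fun n => Finset.measurable_fun_prod _ fun k _ =>
      measurable_const.sub (hg.comp (hY k))
  · exact fun i j hij ω => antitone_prod_one_sub (fun k => g (Y k ω)) hij
  · simp

lemma intervalIntegrable_mul_of_le_one {q : ℝ → ℝ} (hq : Measurable q) (hq0 : ∀ r, 0 ≤ q r)
    (hq1 : ∀ r, q r ≤ 1) (a b : ℝ) : IntervalIntegrable (fun r => r * q r) volume a b := by
  refine (intervalIntegral.intervalIntegrable_id (a := a) (b := b)).mono_fun
    ((measurable_id.mul hq).aestronglyMeasurable) (Filter.Eventually.of_forall fun r => ?_)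
  simp only [norm_mul, Real.norm_eq_abs]
  rw [abs_of_nonneg (hq0 r)]
  exact mul_le_of_le_one_right (abs_nonneg r) (hq1 r)

/-- Integration in polar coordinates over a disc. -/
lemma lintegral_ball_norm {q : ℝ → ℝ} (hq : Measurable q) (hq0 : ∀ r, 0 ≤ q r) {ρ : ℝ}
    (hρ : 0 ≤ ρ) :
    (∫⁻ y : Plane, (Metric.ball 0 ρ).indicator (fun y => ENNReal.ofReal (q ‖y‖)) y).toReal =
      2 * Real.pi * ∫ r in (0 : ℝ)..ρ, r * q r := by
  have hind : ∀ y : Plane, (Metric.ball 0 ρ).indicator (fun y => ENNReal.ofReal (q ‖y‖)) y =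
      ENNReal.ofReal ((Set.Iio ρ).indicator q ‖y‖) := fun y => by
    by_cases hy : ‖y‖ < ρ <;> simp [hy]
  have hmeas : Measurable ((Set.Iio ρ).indicator q) := hq.indicator measurableSet_Iio
  simp only [hind]
  rw [← integral_eq_lintegral_of_nonneg_ae
    (Filter.Eventually.of_forall fun y => Set.indicator_nonneg (fun r _ => hq0 r) _)
    (hmeas.comp measurable_norm).aestronglyMeasurable,
    integral_fun_norm_addHaar volume ((Set.Iio ρ).indicator q), volume_real_ball_plane 0 zero_le_one]
  have hdim : Module.finrank ℝ Plane = 2 := finrank_euclideanSpace_fin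
  have hcongr : ∀ r : ℝ, r ^ (Module.finrank ℝ Plane - 1) • (Set.Iio ρ).indicator q r =
      (Set.Iio ρ).indicator (fun r => r * q r) r := fun r => by
    by_cases hr : r < ρ <;> simp [hr, hdim]
  simp only [hcongr]
  rw [setIntegral_indicator measurableSet_Iio, Set.Ioi_inter_Iio, ← integral_Ioc_eq_integral_Ioo,
    ← intervalIntegral.integral_of_le hρ, hdim]
  simp
  ring

/-- Random displacement preserves the intensity: by translation invariance of Lebesgue measure the
law of the displacement vector is irrelevant. -/
lemma lintegral_lintegral_add {Θ : Type*} [MeasurableSpace Θ] (ν : Measure Θ)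
    [IsProbabilityMeasure ν] {v : Θ → Plane} (hv : Measurable v) {f : Plane → ℝ≥0∞}
    (hf : Measurable f) : ∫⁻ y : Plane, ∫⁻ θ, f (y + v θ) ∂ν = ∫⁻ y, f y := by
  have hm : Measurable (Function.uncurry fun (y : Plane) θ => f (y + v θ)) :=
    hf.comp (measurable_fst.add (hv.comp measurable_snd))
  rw [lintegral_lintegral_swap hm.aemeasurable]
  simp only [lintegral_add_right_eq_self f, lintegral_const, measure_univ, mul_one]

/-! ### Mark distributions and the LoS probability -/

lemma measurable_direction : Measurable fun θ : ℝ => !₂[Real.cos θ, Real.sin θ] := by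
  refine (WithLp.measurable_toLp 2 (Fin 2 → ℝ)).comp (measurable_pi_lambda _ fun j => ?_)
  fin_cases j
  · exact Real.measurable_cos
  · exact Real.measurable_sin

lemma norm_direction (θ : ℝ) : ‖!₂[Real.cos θ, Real.sin θ]‖ = 1 := by
  simp [EuclideanSpace.norm_eq]

lemma cond_Icc_zero_one_Iic {a : ℝ} (h1 : a ≤ 1) :
    cond volume (Set.Icc (0 : ℝ) 1) {l | l ≤ a} = ENNReal.ofReal a := by
  have hset : Set.Icc (0 : ℝ) 1 ∩ {l | l ≤ a} = Set.Icc 0 a := by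
    ext l
    simp only [Set.mem_inter_iff, Set.mem_Icc, Set.mem_ofPred_eq]
    exact ⟨fun h => ⟨h.1.1, h.2⟩, fun h => ⟨⟨h.1, h.2.trans h1⟩, h.2⟩⟩
  rw [cond_apply measurableSet_Icc, hset]
  simp

lemma cond_Icc_zero_one_Iic_compl {a : ℝ} (h0 : 0 ≤ a) (h1 : a ≤ 1) :
    cond volume (Set.Icc (0 : ℝ) 1) {l | ¬ l ≤ a} = ENNReal.ofReal (1 - a) := by
  have : IsProbabilityMeasure (cond volume (Set.Icc (0 : ℝ) 1)) :=
    cond_isProbabilityMeasure_of_finite (by simp) (by simp)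
  have h := prob_compl_eq_one_sub (μ := cond volume (Set.Icc (0 : ℝ) 1))
    (measurableSet_Iic (a := a))
  rw [ENNReal.ofReal_sub _ h0, ENNReal.ofReal_one, ← cond_Icc_zero_one_Iic h1]
  exact h

namespace Params

variable (P) in
lemma measurable_pL (i : Fin N) : Measurable (P.pL i) := by
  have he : Measurable fun r => elevation r (P.h i) :=
    Measurable.ite (measurableSet_singleton 0) measurable_const
      (Real.measurable_arctan.comp (measurable_const.div measurable_id))
  unfold pL probLoS
  fun_prop

variable (P) in
lemma pL_nonneg (i : Fin N) (r : ℝ) : 0 ≤ P.pL i r := by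
  have := P.a_pos
  unfold pL probLoS
  positivity

variable (P) in
lemma pL_le_one (i : Fin N) (r : ℝ) : P.pL i r ≤ 1 := by
  have := P.a_pos
  unfold pL probLoS
  refine div_le_one_of_le₀ ?_ (by positivity)
  simp only [le_add_iff_nonneg_right]
  positivity

end Params

/-! ### Clusters with an ABS that passes a test -/

variable (P) in
/-- The pairs of a cluster center (relative to the user) and a mark for which the cluster has an ABS
with GS in ring `i` at horizontal distance `r < ρ` from the user whose LoS variable `l` satisfies
`(r, l) ∈ L`. Both the LoS and the NLoS condition are of this form. -/
def hitSet (i : Fin N) (ρ : ℝ) (L : Set (ℝ × ℝ)) :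
    Set (Plane × ((ℕ → Plane) × Bool × ℝ × ℝ)) :=
  {p | (P.ringRadius i < ⨅ j, ‖p.2.1 j‖ ∧ ⨅ j, ‖p.2.1 j‖ < P.ringRadius ((i : ℕ) + 1)) ∧
    p.2.2.1 = true ∧
    p.1 + P.Ru i • !₂[Real.cos p.2.2.2.1, Real.sin p.2.2.2.1] ∈ Metric.ball 0 ρ ∧
    (‖p.1 + P.Ru i • !₂[Real.cos p.2.2.2.1, Real.sin p.2.2.2.1]‖, p.2.2.2.2) ∈ L}

lemma measurable_iInf_norm : Measurable fun R : ℕ → Plane => ⨅ j, ‖R j‖ :=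
  Measurable.iInf fun j => (measurable_pi_apply j).norm

/-- The part of `hitSet` that concerns the direction and the LoS variable. -/
lemma measurableSet_angle_los (i : Fin N) (ρ : ℝ) {L : Set (ℝ × ℝ)} (hL : MeasurableSet L) :
    MeasurableSet {p : Plane × ℝ × ℝ |
      p.1 + P.Ru i • !₂[Real.cos p.2.1, Real.sin p.2.1] ∈ Metric.ball 0 ρ ∧
        (‖p.1 + P.Ru i • !₂[Real.cos p.2.1, Real.sin p.2.1]‖, p.2.2) ∈ L} := by
  have hv : Measurable fun p : Plane × ℝ × ℝ =>
      p.1 + P.Ru i • !₂[Real.cos p.2.1, Real.sin p.2.1] :=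
    measurable_fst.add
      ((measurable_direction.comp (measurable_fst.comp measurable_snd)).const_smul (P.Ru i))
  exact (hv measurableSet_ball).inter
    ((hv.norm.prodMk (measurable_snd.comp measurable_snd)) hL)

lemma measurableSet_hitSet (i : Fin N) (ρ : ℝ) {L : Set (ℝ × ℝ)} (hL : MeasurableSet L) :
    MeasurableSet (hitSet P i ρ L) := by
  have hR : Measurable fun p : Plane × ((ℕ → Plane) × Bool × ℝ × ℝ) => ⨅ j, ‖p.2.1 j‖ :=
    measurable_iInf_norm.comp (measurable_fst.comp measurable_snd)
  have hD : Measurable fun p : Plane × ((ℕ → Plane) × Bool × ℝ × ℝ) => p.2.2.1 := by fun_prop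
  have hT : Measurable fun p : Plane × ((ℕ → Plane) × Bool × ℝ × ℝ) =>
      (p.1, p.2.2.2.1, p.2.2.2.2) := by fun_prop
  exact (hR measurableSet_Ioo).inter ((hD (measurableSet_singleton true)).inter
    (hT (measurableSet_angle_los i ρ hL)))

variable (P) in
/-- The probability that a cluster with center at `y` (relative to the user) has an ABS with GS in
ring `i` at horizontal distance `r < ρ` from the user which passes a test with success probability
`q r`. -/
noncomputable def hitProb (i : Fin N) (ρ : ℝ) (q : ℝ → ℝ) (y : Plane) : ℝ≥0∞ :=
  ENNReal.ofReal (P.ringProb i * P.δ) *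
    ∫⁻ θ, (Metric.ball (0 : Plane) ρ).indicator (fun z => ENNReal.ofReal (q ‖z‖))
      (y + P.Ru i • !₂[Real.cos θ, Real.sin θ]) ∂cond volume (Set.Icc 0 (2 * Real.pi))

variable {q : ℝ → ℝ}

lemma measurable_indicator_ball_norm (hq : Measurable q) (ρ : ℝ) :
    Measurable ((Metric.ball (0 : Plane) ρ).indicator fun z => ENNReal.ofReal (q ‖z‖)) :=
  (hq.comp measurable_norm).ennreal_ofReal.indicator measurableSet_ball

lemma isProbabilityMeasure_angle :
    IsProbabilityMeasure (cond volume (Set.Icc 0 (2 * Real.pi))) := by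
  refine cond_isProbabilityMeasure_of_finite ?_ isCompact_Icc.measure_lt_top.ne
  simp [Real.pi_pos]

lemma measurable_hitProb (hq : Measurable q) (i : Fin N) (ρ : ℝ) :
    Measurable (hitProb P i ρ q) := by
  have := isProbabilityMeasure_angle
  have hm : Measurable fun p : Plane × ℝ =>
      (Metric.ball (0 : Plane) ρ).indicator (fun z => ENNReal.ofReal (q ‖z‖))
        (p.1 + P.Ru i • !₂[Real.cos p.2, Real.sin p.2]) :=
    (measurable_indicator_ball_norm hq ρ).comp (measurable_fst.add
      ((measurable_direction.comp measurable_snd).const_smul (P.Ru i)))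
  exact hm.lintegral_prod_right'.const_mul _

lemma isBounded_support_hitProb (i : Fin N) (ρ : ℝ) :
    Bornology.IsBounded (Function.support (hitProb P i ρ q)) := by
  refine (Metric.isBounded_ball (x := (0 : Plane)) (r := ρ + P.Ru i)).subset fun y hy => ?_
  by_contra hfar
  refine hy ?_
  have hzero : ∀ θ : ℝ, (Metric.ball (0 : Plane) ρ).indicator (fun z => ENNReal.ofReal (q ‖z‖))
      (y + P.Ru i • !₂[Real.cos θ, Real.sin θ]) = 0 := fun θ => by
    refine Set.indicator_of_notMem (fun hmem => hfar ?_) _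
    rw [mem_ball_zero_iff] at hmem ⊢
    have hnorm : ‖P.Ru i • !₂[Real.cos θ, Real.sin θ]‖ = P.Ru i := by
      rw [norm_smul, norm_direction, mul_one, Real.norm_of_nonneg (P.Ru_nonneg i)]
    have htri := norm_sub_le (y + P.Ru i • !₂[Real.cos θ, Real.sin θ])
      (P.Ru i • !₂[Real.cos θ, Real.sin θ])
    rw [add_sub_cancel_right, hnorm] at htri
    linarith
  simp [hitProb, hzero]

lemma lintegral_hitProb (hq : Measurable q) (hq0 : ∀ r, 0 ≤ q r) (i : Fin N) {ρ : ℝ}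
    (hρ : 0 ≤ ρ) : (∫⁻ y, hitProb P i ρ q y).toReal =
      P.ringProb i * P.δ * (2 * Real.pi * ∫ r in (0 : ℝ)..ρ, r * q r) := by
  have := isProbabilityMeasure_angle
  simp only [hitProb]
  rw [lintegral_const_mul' _ _ ENNReal.ofReal_ne_top,
    lintegral_lintegral_add _ (v := fun θ => P.Ru i • !₂[Real.cos θ, Real.sin θ])
      (measurable_direction.const_smul (P.Ru i)) (measurable_indicator_ball_norm hq ρ),
    ENNReal.toReal_mul, lintegral_ball_norm hq hq0 hρ,
    ENNReal.toReal_ofReal (mul_nonneg (P.ringProb_nonneg i) P.δ_nonneg)]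

namespace Network

variable (S : Network P μ)

/-- The marks of a cluster. -/
def mark (k : ℕ) (ω : Ω) : (ℕ → Plane) × Bool × ℝ × ℝ :=
  ((fun j => S.rooftop k j ω), S.deployed k ω, S.angle k ω, S.losMark k ω)

lemma measurable_mark (k : ℕ) : Measurable (S.mark k) :=
  (measurable_pi_lambda _ fun j => (S.rooftop_ppp k).measurable j).prodMk
    ((S.deployed_measurable k).prodMk ((S.angle_measurable k).prodMk (S.losMark_measurable k)))

lemma mem_hitSet_iff {i : Fin N} {ρ : ℝ} {L : Set (ℝ × ℝ)} {k : ℕ} {ω : Ω} :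
    (S.center k ω - S.user ω, S.mark k ω) ∈ hitSet P i ρ L ↔
      S.HasABS i k ω ∧ ‖S.absLoc i k ω - S.user ω‖ < ρ ∧
        (‖S.absLoc i k ω - S.user ω‖, S.losMark k ω) ∈ L := by
  have hloc : S.center k ω - S.user ω + P.Ru i • !₂[Real.cos (S.angle k ω), Real.sin (S.angle k ω)] =
      S.absLoc i k ω - S.user ω := sub_add_eq_add_sub _ _ _
  simp only [hitSet, mark, Set.mem_ofPred_eq, hloc, mem_ball_zero_iff, HasABS, rooftopDist]
  tauto

variable [IsProbabilityMeasure μ]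

/-- The mark of a cluster with center at `y` hits with probability `hitProb`: the rooftops, the
deployment, the direction and the LoS variable contribute the factors `p_i`, `δ`, the mean over
`θ`, and `q`. -/
lemma measure_mark_mem_hitSet (i : Fin N) (ρ : ℝ) {L : Set (ℝ × ℝ)} (hL : MeasurableSet L)
    {q : ℝ → ℝ} (hLq : ∀ r, cond volume (Set.Icc (0 : ℝ) 1) {l | (r, l) ∈ L} = ENNReal.ofReal (q r))
    (k : ℕ) (y : Plane) :
    μ {ω | (y, S.mark k ω) ∈ hitSet P i ρ L} = hitProb P i ρ q y := by
  have hRm : Measurable fun ω j => S.rooftop k j ω :=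
    measurable_pi_lambda _ fun j => (S.rooftop_ppp k).measurable j
  let T : Set (ℝ × ℝ) := Prod.mk y ⁻¹' {p : Plane × ℝ × ℝ |
      p.1 + P.Ru i • !₂[Real.cos p.2.1, Real.sin p.2.1] ∈ Metric.ball 0 ρ ∧
        (‖p.1 + P.Ru i • !₂[Real.cos p.2.1, Real.sin p.2.1]‖, p.2.2) ∈ L}
  have hT : MeasurableSet T := measurable_prodMk_left (measurableSet_angle_los i ρ hL)
  have hRing : MeasurableSet {R : ℕ → Plane | P.ringRadius i < ⨅ j, ‖R j‖ ∧
      ⨅ j, ‖R j‖ < P.ringRadius ((i : ℕ) + 1)} := measurable_iInf_norm measurableSet_Ioo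
  have h1 : μ {ω | (y, S.mark k ω) ∈ hitSet P i ρ L} =
      μ {ω | P.ringRadius i < S.rooftopDist k ω ∧
        S.rooftopDist k ω < P.ringRadius ((i : ℕ) + 1)} *
      μ ((fun ω => (S.deployed k ω, S.angle k ω, S.losMark k ω)) ⁻¹' ({true} ×ˢ T)) :=
    (S.indep_rooftop k).measure_inter_preimage_eq_mul _ _ hRing
      ((measurableSet_singleton true).prod hT)
  have h2 : μ ((fun ω => (S.deployed k ω, S.angle k ω, S.losMark k ω)) ⁻¹' ({true} ×ˢ T)) =
      μ {ω | S.deployed k ω = true} * μ ((fun ω => (S.angle k ω, S.losMark k ω)) ⁻¹' T) :=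
    (S.indep_deployed k).measure_inter_preimage_eq_mul _ _ (measurableSet_singleton true) hT
  have hδ : μ {ω | S.deployed k ω = true} = ENNReal.ofReal P.δ := by
    rw [← S.deployed_law k, ofReal_measureReal]
  have h3 : μ ((fun ω => (S.angle k ω, S.losMark k ω)) ⁻¹' T) =
      ∫⁻ θ, (Metric.ball (0 : Plane) ρ).indicator (fun z => ENNReal.ofReal (q ‖z‖))
        (y + P.Ru i • !₂[Real.cos θ, Real.sin θ]) ∂cond volume (Set.Icc 0 (2 * Real.pi)) := by
    have ha : μ.map (S.angle k) = cond volume (Set.Icc 0 (2 * Real.pi)) := S.angle_uniform k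
    have hl : μ.map (S.losMark k) = cond volume (Set.Icc 0 1) := S.losMark_uniform k
    rw [← Measure.map_apply ((S.angle_measurable k).prodMk (S.losMark_measurable k)) hT,
      (S.indep_angle k).map_prod_eq_prod_map_map (S.angle_measurable k).aemeasurable
        (S.losMark_measurable k).aemeasurable, Measure.prod_apply hT, ha, hl]
    refine lintegral_congr fun θ => ?_
    by_cases hz : y + P.Ru i • !₂[Real.cos θ, Real.sin θ] ∈ Metric.ball (0 : Plane) ρ
    · rw [Set.indicator_of_mem hz, ← hLq]
      congr 1
      ext l
      exact and_iff_right hz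
    · rw [Set.indicator_of_notMem hz]
      convert measure_empty (μ := cond volume (Set.Icc (0 : ℝ) 1))
      ext l
      exact iff_of_false (fun h => hz h.1) (Set.notMem_empty l)
  rw [h1, h2, h3, hδ, S.measure_rooftopDist_mem_ring, hitProb,
    ENNReal.ofReal_mul (P.ringProb_nonneg i), mul_assoc]

/-- The probability that some ABS with GS in ring `i` at horizontal distance `r < ρ` from the user
passes a test that succeeds with conditional probability `q r`. -/
theorem measureReal_exists_abs (i : Fin N) {ρ : ℝ} (hρ : 0 ≤ ρ) {L : Set (ℝ × ℝ)}
    (hL : MeasurableSet L) (hq : Measurable q) (hq0 : ∀ r, 0 ≤ q r)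
    (hLq : ∀ r, cond volume (Set.Icc (0 : ℝ) 1) {l | (r, l) ∈ L} = ENNReal.ofReal (q r)) :
    μ.real {ω | ∃ k, S.HasABS i k ω ∧ ‖S.absLoc i k ω - S.user ω‖ < ρ ∧
        (‖S.absLoc i k ω - S.user ω‖, S.losMark k ω) ∈ L} =
      1 - Real.exp (-2 * Real.pi * P.ringProb i * P.δ * P.lamC *
        ∫ r in (0 : ℝ)..ρ, r * q r) := by
  simp only [← mem_hitSet_iff]
  have hYm : ∀ k, Measurable fun ω => S.center k ω - S.user ω := fun k =>
    (S.measurable_center k).sub S.user_measurable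
  have hA := measurableSet_hitSet (P := P) i ρ hL
  have hm : MeasurableSet
      {ω | ∃ k, (S.center k ω - S.user ω, S.mark k ω) ∈ hitSet P i ρ L} := by
    rw [Set.ofPred_exists]
    exact MeasurableSet.iUnion fun k => ((hYm k).prodMk (S.measurable_mark k)) hA
  refine measureReal_eq_one_sub_of_compl hm ?_
  have hind : IndepFun (fun ω k => S.center k ω - S.user ω) (fun ω k => S.mark k ω) μ :=
    S.indep_marks.comp (φ := fun (p : Plane × (ℕ → Plane)) k => p.2 k - p.1) (ψ := id)
      (measurable_pi_lambda _ fun k =>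
        ((measurable_pi_apply k).comp measurable_snd).sub measurable_fst) measurable_id
  have hhit := S.measure_mark_mem_hitSet i ρ hL hLq
  have h1 : ∀ y, hitProb P i ρ q y ≤ 1 := fun y => by
    rw [← hhit 0 y]
    exact prob_le_one
  have h := measure_forall_mark_notMem hYm S.measurable_mark hind S.indep_clusters hA
    (measurable_hitProb hq i ρ) hhit
  rw [S.center_ppp.lintegral_survival_sub P.lamC_pos.le S.user_measurable S.indep_center
    (measurable_hitProb hq i ρ) h1 (isBounded_support_hitProb i ρ),
    lintegral_hitProb hq hq0 i hρ] at h
  convert h using 2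
  · ext ω
    simp
  · congr 1; ring

/-! ### Distances to the closest ABSs -/

/-- The law of the Euclidean distance to the closest ABS with GS in ring `i` that passes a test with
conditional success probability `q r`. -/
lemma cdfOf_dist_abs (i : Fin N) {L : Set (ℝ × ℝ)} (hL : MeasurableSet L) (hq : Measurable q)
    (hq0 : ∀ r, 0 ≤ q r) (hq1 : ∀ r, q r ≤ 1)
    (hLq : ∀ r, cond volume (Set.Icc (0 : ℝ) 1) {l | (r, l) ∈ L} = ENNReal.ofReal (q r))
    {D : Ω → EReal} (hD : ∀ ω, D ω = ⨅ y ∈ {y | ∃ k, S.HasABS i k ω ∧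
      (‖S.absLoc i k ω - S.user ω‖, S.losMark k ω) ∈ L ∧ y = S.absLoc i k ω},
        ((Real.sqrt (‖y - S.user ω‖ ^ 2 + P.h i ^ 2) : ℝ) : EReal)) (d : ℝ) :
    cdfOf μ D d = (Set.Ici (P.h i)).indicator
      (fun d => 1 - Real.exp (-2 * Real.pi * P.ringProb i * P.δ * P.lamC *
        ∫ r in (0 : ℝ)..Real.sqrt (d ^ 2 - P.h i ^ 2), r * q r)) d := by
  have hh := P.h_nonneg i
  by_cases hd : P.h i ≤ d
  · rw [Set.indicator_of_mem (Set.mem_Ici.2 hd)]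
    have hprim := intervalIntegral.continuous_primitive
      (intervalIntegrable_mul_of_le_one hq hq0 hq1) 0
    refine cdfOf_eq_of_lt (F := fun d => 1 - Real.exp (-2 * Real.pi * P.ringProb i * P.δ * P.lamC *
        ∫ r in (0 : ℝ)..Real.sqrt (d ^ 2 - P.h i ^ 2), r * q r)) ?_ fun d' hd' => ?_
    · have hcomp : Continuous fun d : ℝ =>
          ∫ r in (0 : ℝ)..Real.sqrt (d ^ 2 - P.h i ^ 2), r * q r :=
        hprim.comp (by fun_prop)
      fun_prop
    · rw [← S.measureReal_exists_abs i (Real.sqrt_nonneg _) hL hq hq0 hLq]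
      have h0 : 0 ≤ d' := hh.trans (hd.trans hd')
      have hsqrt : ∀ r : ℝ, 0 ≤ r →
          (Real.sqrt (r ^ 2 + P.h i ^ 2) < d' ↔ r < Real.sqrt (d' ^ 2 - P.h i ^ 2)) :=
        fun r hr => by
          rw [Real.lt_sqrt hr, lt_sub_iff_add_lt, Real.sqrt_lt (by positivity) h0]
      congr 1
      ext ω
      simp only [hD, Set.mem_ofPred_eq, iInf_lt_iff, EReal.coe_lt_coe_iff]
      constructor
      · rintro ⟨_, ⟨k, hk, hLk, rfl⟩, hlt⟩
        exact ⟨k, hk, (hsqrt _ (norm_nonneg _)).1 hlt, hLk⟩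
      · rintro ⟨k, hk, hlt, hLk⟩
        exact ⟨_, ⟨k, hk, hLk, rfl⟩, (hsqrt _ (norm_nonneg _)).2 hlt⟩
  -- Below the altitude the event is empty: the distance is at least `h i`.
  · rw [Set.indicator_of_notMem (by simpa using hd), cdfOf]
    convert measureReal_empty (μ := μ)
    ext ω
    simp only [Set.mem_ofPred_eq, Set.mem_empty_iff_false, iff_false, not_le, hD]
    refine lt_of_lt_of_le (EReal.coe_lt_coe_iff.2 (not_le.1 hd)) (le_iInf₂ fun y _ => ?_)
    rw [EReal.coe_le_coe_iff]
    exact Real.le_sqrt_of_sq_le (by nlinarith [sq_nonneg ‖y - S.user ω‖])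

end Network
end TUAV

theorem lemma1 {N : ℕ} (P : TUAV.Params N) {Ω : Type*} [MeasurableSpace Ω]
    (μ : Measure Ω) [IsProbabilityMeasure μ] (S : TUAV.Network P μ) :
    (∀ d : ℝ, TUAV.cdfOf μ S.distT d =
      (Set.Ici (0 : ℝ)).indicator
        (fun d => 1 - Real.exp (-Real.pi * P.lamT * d ^ 2)) d) ∧
    (∀ (i : Fin N) (d : ℝ), TUAV.cdfOf μ (S.distL i) d =
      (Set.Ici (P.h i)).indicator
        (fun d => 1 - Real.exp (-2 * Real.pi * P.ringProb i * P.δ * P.lamC *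
          ∫ r in (0 : ℝ)..Real.sqrt (d ^ 2 - P.h i ^ 2), r * P.pL i r)) d) ∧
    (∀ (i : Fin N) (d : ℝ), TUAV.cdfOf μ (S.distN i) d =
      (Set.Ici (P.h i)).indicator
        (fun d => 1 - Real.exp (-2 * Real.pi * P.ringProb i * P.δ * P.lamC *
          ∫ r in (0 : ℝ)..Real.sqrt (d ^ 2 - P.h i ^ 2), r * P.pN i r)) d) := by
  refine ⟨fun d => ?_, fun i d => ?_, fun i d => ?_⟩
  · by_cases hd : 0 ≤ d
    · rw [Set.indicator_of_mem (Set.mem_Ici.2 hd), S.cdfOf_distT d hd]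
    · rw [Set.indicator_of_notMem (by simpa using hd), TUAV.cdfOf]
      convert measureReal_empty (μ := μ)
      ext ω
      simp only [Set.mem_ofPred_eq, Set.mem_empty_iff_false, iff_false, not_le, TUAV.Network.distT]
      refine lt_of_lt_of_le (EReal.coe_lt_coe_iff.2 (not_le.1 hd)) (le_iInf₂ fun y _ => ?_)
      exact EReal.coe_le_coe_iff.2 (norm_nonneg _)
  · have hp := P.measurable_pL i
    exact S.cdfOf_dist_abs i (L := {p | p.2 ≤ P.pL i p.1})
      (measurableSet_le measurable_snd (hp.comp measurable_fst)) hp (P.pL_nonneg i)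
      (P.pL_le_one i) (fun r => TUAV.cond_Icc_zero_one_Iic (P.pL_le_one i r)) (fun ω => rfl) d
  · have hp := P.measurable_pL i
    exact S.cdfOf_dist_abs i (L := {p | ¬ p.2 ≤ P.pL i p.1})
      (measurableSet_le measurable_snd (hp.comp measurable_fst)).compl (measurable_const.sub hp)
      (fun r => sub_nonneg.2 (P.pL_le_one i r)) (fun r => sub_le_self 1 (P.pL_nonneg i r))
      (fun r => TUAV.cond_Icc_zero_one_Iic_compl (P.pL_nonneg i r) (P.pL_le_one i r))
      (fun ω => rfl) d
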